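/- **Setting.** Let $\mathbb S$ be a category with pushouts, pullbacks and binary products. A *$J$-opcategory* $\mathbf X$ in $\mathbb S$ (a polyad in the cospans of $\mathbb S$) consists of objects $\mathbf X[0,i]$, cospans $\mathbf X[0,i]\xrightarrow{in}\mathbf X[1,ij]\xleftarrow{out}\mathbf X[0,j]$, units $\eta_i:\mathbf X[0,i]\to\mathbf X[1,ii]$ and multiplications $\mu_{ijk}:\mathbf X[1,ij]+_{\mathbf X[0,j]}\mathbf X[1,jk]\to\mathbf X[1,ik]$ for $i,j,k\in J$, which are 2-cells of cospans and are unital and associative. An *internal functor* consists of a map on colors and maps on the objects $[0,i]$ and $[1,ij]$, compatible with this structure; it is *plain* if it is the identity on colors. A *game* of color $i$ is a map $\lambda_A:A\to\mathbf X[0,i]$. A *cobordism* from $(A,\lambda_A)$ of color $i$ to $(B,\lambda_B)$ of color $j$ is a cospan $A\to S\leftarrow B$ with a map $\lambda:S\to\mathbf X[1,ij]$ compatible with $in\circ\lambda_A$ and $out\circ\lambda_B$; a *map* (written $\to$) between cobordisms with the same borders is a map of supports that commutes with the cospan legs and with $\lambda$. Sequential composition $\sigma;\tau$ is the pushout of the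 supports over the common border, relabeled along $\mu$. The parallel product $\|$ is given by a span of internal functors $\mathbf X\times\mathbf X\xleftarrow{pick}\mathbf X^{\|}\xrightarrow{pince}\mathbf X$ with $pick$ plain: on games and on cobordisms, pull the pointwise product back along $pick$, then postcompose the label with $pince$. A *filling system* $\mathrm{Fill}$ assigns to any two games $\lambda$ on $B$ and $\mu$ on $B'$ (of any colors) a cobordism $\mathrm{Fill}(\lambda,\mu)$ from $(B,\lambda)$ to $(B',\mu)$. For cobordisms $C_1$ from $A$ to $(B,\lambda)$ and $C_2$ from $(B',\mu)$ to $C$ put $C_1\,\mathbin{\overset{\circ}{;}}\,C_2=(C_1;\mathrm{Fill}(\lambda,\mu));C_2$. **Proposition.** (1) Let $C_1$ be a cobordism ending at the game $\lambda$, $C_2$ one starting at $\mu$, $C_1'$ one ending at $\lambda'$, and $C_2'$ one starting at $\mu'$. If there is a map $\mathrm{Fill}(\lambda\|\lambda',\mu\|\mu')\to\mathrm{Fill}(\lambda,\mu)\,\|\,\mathrm{Fill}(\lambda',\mu')$, then the Hoare inequality holds: there is a map $$(C_1\| C_1')\,\mathbin{\overset{\circ}{;}}\,(C_2\| C_2')\;\longrightarrow\;(C_1\,\mathbin{\overset{\circ}{;}}\,C_2)\,\|\,(C_1'\,\mathbin{\overset{\circ}{;}}\,C_2').$$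 (2) For the canonical filling system, where the support of $\mathrm{Fill}(\lambda,\mu)$ is the pushout $B+_{P}B'$ over the pullback $P=B\times_{\mathbf X[1,ij]}B'$ of $in\circ\lambda$ and $out\circ\mu$, the hypothesis of (1) holds for all games $\lambda,\lambda',\mu,\mu'$ when $\mathbf X$ is the stateful or the stateless template. More generally it holds for the template of any asynchronous graph $M$, which is the one-color opcategory in asynchronous graphs (graphs with a set of tiles mapped to the squares formed by two parallel paths of length 2, and a symmetry on tiles that exchanges the two paths; morphisms preserve all of this) given as follows. Let $\Omega(L)$ be the asynchronous graph with one node, edge set $L$ and one tile for each square. Then $\mathbf X[0]=M$, $\mathbf X[1]=M\times\Omega\{C,F\}$, $in=out$ gives each edge the polarity $F$, and $\mu$ is the codiagonal. The span of its parallel product has $\mathbf X^{\|}[0]=M$ and $\mathbf X^{\|}[1]=M^{\circ\circ\bullet}$, the pullback of $M\times\Omega\{C,F\}\to\Omega\{C,F\}\leftarrow\Omega\{C_1,C_2,F\}$ along $C_1,C_2\mapsto C$, $F\mapsto F$. On $[1]$, $pick$ is the pair of relabelings $(C_1\mapsto C;\ C_2,F\mapsto F)$ and $(C_2\mapsto C;\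 C_1,F\mapsto F)$, and $pince$ is the relabeling $(C_1,C_2\mapsto C;\ F\mapsto F)$; on $[0]$ they are the diagonal and the identity. In the stateful template the nodes of $M$ are the machine states (finite partial stack, finite partial heap, set of locks) and an error node. Its edges are the transitions of the instructions $x:=E$, $x:=[E]$, $[E]:=E'$, $\mathrm{test}(B)$, $\mathrm{nop}$, $x:=\mathrm{alloc}(E,\ell)$, $\mathrm{dispose}(E)$, $P(r)$, $V(r)$. Its tiles are the squares $s\xrightarrow{m}s_1\xrightarrow{m'}s'\sim s\xrightarrow{m'}s_2\xrightarrow{m}s'$ in which the footprints of $m$ and $m'$ (memory read, memory written, locks touched, addresses allocated or deallocated) are independent: neither of the two instructions writes what the other one reads or writes, and they share no touched locks and no allocated or deallocated addresses. In the stateless template the nodes of $M$ are the sets of locks and an error node. Its edges are $L\xrightarrow{P(r)}L\uplus\{r\}$, $L\uplus\{r\}\xrightarrow{V(r)}L$, $L\to L$ for $\mathrm{alloc}(\ell)$, $\mathrm{dispose}(\ell)$ and $\tau$, and $L\xrightarrow{m}\mathrm{error}$ for each of these instructions $m$. Its tiles are the squares of the same form in which $m$ and $m'$ involve disjoint sets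 of locks and disjoint sets of locations. -/

import Mathlib

open CategoryTheory CategoryTheory.Limits

universe u v w t

set_option linter.unusedSimpArgs false

namespace Cobord

section Opcategories

variable {S : Type u} [Category.{v} S]

/-- An internal `J`-opcategory in `S`: a polyad in the double category of cospans of `S`.
`mu i j k` is a 2-cell from the composite of the cospans `obj1 i j` and `obj1 j k` (a pushout over
`obj0 j`) to `obj1 i k`. The equations between maps out of a composite of cospans are spelled out
on the pieces that are glued (a map out of a pushout is determined by its two restrictions). -/
structure Opcategory (S : Type u) [Category.{v} S] [HasPushouts S] (J : Type w) where
  obj0 : J → S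
  obj1 : J → J → S
  inp : ∀ i j, obj0 i ⟶ obj1 i j
  out : ∀ i j, obj0 j ⟶ obj1 i j
  eta : ∀ i, obj0 i ⟶ obj1 i i
  mu : ∀ i j k, pushout (out i j) (inp j k) ⟶ obj1 i k
  /-- `eta i` is a 2-cell from the identity cospan. -/
  eta_inp : ∀ i, eta i = inp i i
  eta_out : ∀ i, eta i = out i i
  /-- `mu i j k` is a 2-cell of cospans. -/
  inp_mu : ∀ i j k, inp i j ≫ pushout.inl (out i j) (inp j k) ≫ mu i j k = inp i k
  out_mu : ∀ i j k, out j k ≫ pushout.inr (out i j) (inp j k) ≫ mu i j k = out i k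
  /-- Left unit law: the composite `id ; obj1 i j ⟶ obj1 i i ; obj1 i j ⟶ obj1 i j` is the
  unitor. (On the other piece this is `eta_out` with `inp_mu`.) -/
  unit_left : ∀ i j, pushout.inr (out i i) (inp i j) ≫ mu i i j = 𝟙 (obj1 i j)
  /-- Right unit law. -/
  unit_right : ∀ i j, pushout.inl (out i j) (inp j j) ≫ mu i j j = 𝟙 (obj1 i j)
  /-- Associativity, on each of the three pieces `obj1 i j`, `obj1 j k`, `obj1 k l`. -/
  assoc_left : ∀ i j k l,
    pushout.inl (out i j) (inp j k) ≫ mu i j k ≫ pushout.inl (out i k) (inp k l) ≫ mu i k l =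
      pushout.inl (out i j) (inp j l) ≫ mu i j l
  assoc_middle : ∀ i j k l,
    pushout.inr (out i j) (inp j k) ≫ mu i j k ≫ pushout.inl (out i k) (inp k l) ≫ mu i k l =
      pushout.inl (out j k) (inp k l) ≫ mu j k l ≫ pushout.inr (out i j) (inp j l) ≫ mu i j l
  assoc_right : ∀ i j k l,
    pushout.inr (out i k) (inp k l) ≫ mu i k l =
      pushout.inr (out j k) (inp k l) ≫ mu j k l ≫ pushout.inr (out i j) (inp j l) ≫ mu i j l

/-- The product of two internal opcategories, indexed by the product of the sets of colors. The
multiplication restricts on the two glued pieces to the products of the restrictions of the two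
multiplications. -/
noncomputable abbrev Opcategory.prod [HasPushouts S] [HasBinaryProducts S] {J J' : Type w}
    (X : Opcategory S J) (Y : Opcategory S J') : Opcategory S (J × J') where
  obj0 p := X.obj0 p.1 ⨯ Y.obj0 p.2
  obj1 p q := X.obj1 p.1 q.1 ⨯ Y.obj1 p.2 q.2
  inp p q := Limits.prod.map (X.inp p.1 q.1) (Y.inp p.2 q.2)
  out p q := Limits.prod.map (X.out p.1 q.1) (Y.out p.2 q.2)
  eta p := Limits.prod.map (X.eta p.1) (Y.eta p.2)
  mu p q r := pushout.desc
    (Limits.prod.map (pushout.inl _ _ ≫ X.mu p.1 q.1 r.1) (pushout.inl _ _ ≫ Y.mu p.2 q.2 r.2))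
    (Limits.prod.map (pushout.inr _ _ ≫ X.mu p.1 q.1 r.1) (pushout.inr _ _ ≫ Y.mu p.2 q.2 r.2))
    (by
      rw [prod.map_map, prod.map_map, pushout.condition_assoc, pushout.condition_assoc])
  eta_inp p := by rw [X.eta_inp, Y.eta_inp]
  eta_out p := by rw [X.eta_out, Y.eta_out]
  inp_mu p q r := by
    simp [pushout.inl_desc, pushout.inr_desc, pushout.inl_desc_assoc, pushout.inr_desc_assoc,
      X.inp_mu, Y.inp_mu]
  out_mu p q r := by
    simp [pushout.inl_desc, pushout.inr_desc, pushout.inl_desc_assoc, pushout.inr_desc_assoc,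
      X.out_mu, Y.out_mu]
  unit_left p q := by
    simp [pushout.inl_desc, pushout.inr_desc, pushout.inl_desc_assoc, pushout.inr_desc_assoc,
      X.unit_left, Y.unit_left]
  unit_right p q := by
    simp [pushout.inl_desc, pushout.inr_desc, pushout.inl_desc_assoc, pushout.inr_desc_assoc,
      X.unit_right, Y.unit_right]
  assoc_left p q r s := by
    simp [pushout.inl_desc, pushout.inr_desc, pushout.inl_desc_assoc, pushout.inr_desc_assoc,
      X.assoc_left, Y.assoc_left]
  assoc_middle p q r s := by
    simp [pushout.inl_desc, pushout.inr_desc, pushout.inl_desc_assoc, pushout.inr_desc_assoc,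
      X.assoc_middle, Y.assoc_middle]
  assoc_right p q r s := by
    simp [pushout.inl_desc, pushout.inr_desc, pushout.inl_desc_assoc, pushout.inr_desc_assoc,
      ← X.assoc_right, ← Y.assoc_right]

/-- The internal opcategory given by a cospan whose two legs are the same map `e`; the unit is `e`
and the multiplication is the codiagonal (both are forced by the laws). It is used for one-point
sets of colors `J`. -/
noncomputable abbrev Opcategory.ofMap [HasPushouts S] (J : Type w) {X₀ X₁ : S} (e : X₀ ⟶ X₁) :
    Opcategory S J where
  obj0 _ := X₀
  obj1 _ _ := X₁
  inp _ _ := e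
  out _ _ := e
  eta _ := e
  mu _ _ _ := pushout.desc (𝟙 X₁) (𝟙 X₁) rfl
  eta_inp _ := rfl
  eta_out _ := rfl
  inp_mu _ _ _ := by simp [pushout.inl_desc, pushout.inr_desc, pushout.inl_desc_assoc, pushout.inr_desc_assoc]
  out_mu _ _ _ := by simp [pushout.inl_desc, pushout.inr_desc, pushout.inl_desc_assoc, pushout.inr_desc_assoc]
  unit_left _ _ := by simp [pushout.inl_desc, pushout.inr_desc, pushout.inl_desc_assoc, pushout.inr_desc_assoc]
  unit_right _ _ := by simp [pushout.inl_desc, pushout.inr_desc, pushout.inl_desc_assoc, pushout.inr_desc_assoc]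
  assoc_left _ _ _ _ := by simp [pushout.inl_desc, pushout.inr_desc, pushout.inl_desc_assoc, pushout.inr_desc_assoc]
  assoc_middle _ _ _ _ := by simp [pushout.inl_desc, pushout.inr_desc, pushout.inl_desc_assoc, pushout.inr_desc_assoc]
  assoc_right _ _ _ _ := by simp [pushout.inl_desc, pushout.inr_desc, pushout.inl_desc_assoc, pushout.inr_desc_assoc]

/-- Internal functors from a `J`-opcategory to a `J'`-opcategory, with action `f` on colors. -/
structure InternalFunctor [HasPushouts S] {J J' : Type w} (f : J → J')
    (X : Opcategory S J) (Y : Opcategory S J') where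
  map0 : ∀ i, X.obj0 i ⟶ Y.obj0 (f i)
  map1 : ∀ i j, X.obj1 i j ⟶ Y.obj1 (f i) (f j)
  inp_map : ∀ i j, X.inp i j ≫ map1 i j = map0 i ≫ Y.inp (f i) (f j)
  out_map : ∀ i j, X.out i j ≫ map1 i j = map0 j ≫ Y.out (f i) (f j)
  eta_map : ∀ i, X.eta i ≫ map1 i i = map0 i ≫ Y.eta (f i)
  mu_map : ∀ i j k,
    X.mu i j k ≫ map1 i k =
      pushout.map (X.out i j) (X.inp j k) (Y.out (f i) (f j)) (Y.inp (f j) (f k))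
        (map1 i j) (map1 j k) (map0 j) (out_map i j) (inp_map j k) ≫ Y.mu (f i) (f j) (f k)

/-- Plain internal functors: those that act as the identity on colors. -/
abbrev PlainFunctor [HasPushouts S] {J : Type w} (X Y : Opcategory S J) :=
  InternalFunctor (fun i => i) X Y

theorem codiagonal_natural [HasPushouts S] {X₀ X₁ Y₀ Y₁ : S} {e : X₀ ⟶ X₁} {e' : Y₀ ⟶ Y₁}
    (a : X₀ ⟶ Y₀) (b : X₁ ⟶ Y₁) (h : e ≫ b = a ≫ e') :
    pushout.desc (𝟙 X₁) (𝟙 X₁) (rfl : e ≫ 𝟙 X₁ = e ≫ 𝟙 X₁) ≫ b =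
      pushout.map e e e' e' b b a h h ≫
        pushout.desc (𝟙 Y₁) (𝟙 Y₁) (rfl : e' ≫ 𝟙 Y₁ = e' ≫ 𝟙 Y₁) := by
  apply pushout.hom_ext <;>
    simp [pushout.inl_desc, pushout.inr_desc, pushout.inl_desc_assoc, pushout.inr_desc_assoc]

/-- A commutative square between two maps is an internal functor between the induced
opcategories. -/
noncomputable abbrev InternalFunctor.ofSquare [HasPushouts S] {J J' : Type w} (f : J → J')
    {X₀ X₁ Y₀ Y₁ : S} {e : X₀ ⟶ X₁} {e' : Y₀ ⟶ Y₁} (a : X₀ ⟶ Y₀) (b : X₁ ⟶ Y₁)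
    (h : e ≫ b = a ≫ e') :
    InternalFunctor f (Opcategory.ofMap J e) (Opcategory.ofMap J' e') where
  map0 _ := a
  map1 _ _ := b
  inp_map _ _ := h
  out_map _ _ := h
  eta_map _ := h
  mu_map _ _ _ := codiagonal_natural a b h

/-- The pairing of two plain internal functors. -/
noncomputable abbrev InternalFunctor.pair [HasPushouts S] [HasBinaryProducts S] {J J' K : Type w}
    {X : Opcategory S K} {Y : Opcategory S J} {Z : Opcategory S J'} {f : K → J} {g : K → J'}
    (F : InternalFunctor f X Y) (G : InternalFunctor g X Z) :
    InternalFunctor (fun k => (f k, g k)) X (Y.prod Z) where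
  map0 i := prod.lift (F.map0 i) (G.map0 i)
  map1 i j := prod.lift (F.map1 i j) (G.map1 i j)
  inp_map i j := by
    simp [Opcategory.prod, prod.comp_lift, prod.lift_map, F.inp_map, G.inp_map]
  out_map i j := by
    simp [Opcategory.prod, prod.comp_lift, prod.lift_map, F.out_map, G.out_map]
  eta_map i := by
    simp [Opcategory.prod, prod.comp_lift, prod.lift_map, F.eta_map, G.eta_map]
  mu_map i j k := by
    apply pushout.hom_ext
    · simp only [Opcategory.prod, prod.comp_lift, F.mu_map, G.mu_map, pushout.inl_desc_assoc,
        Category.assoc]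
      erw [pushout.inl_desc]
      simp only [prod.lift_map]
    · simp only [Opcategory.prod, prod.comp_lift, F.mu_map, G.mu_map, pushout.inr_desc_assoc,
        Category.assoc]
      erw [pushout.inr_desc]
      simp only [prod.lift_map]

/-- An acute span: a span of internal functors whose left leg is plain. -/
structure AcuteSpan [HasPushouts S] {J J' : Type w}
    (X : Opcategory S J) (Y : Opcategory S J') where
  apex : Opcategory S J
  left : PlainFunctor apex X
  color : J → J'
  right : InternalFunctor color apex Y

end Opcategories

section Cobordisms

variable {S : Type u} [Category.{v} S]

/-- An `i`-colored game over `X`. -/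
structure Game [HasPushouts S] {J : Type w} (X : Opcategory S J) (i : J) where
  carrier : S
  label : carrier ⟶ X.obj0 i

/-- An `ij`-colored cobordism from an `i`-colored game to a `j`-colored game. -/
structure Cobordism [HasPushouts S] {J : Type w} {X : Opcategory S J} {i j : J}
    (A : Game X i) (B : Game X j) where
  support : S
  source : A.carrier ⟶ support
  target : B.carrier ⟶ support
  label : support ⟶ X.obj1 i j
  source_label : source ≫ label = A.label ≫ X.inp i j
  target_label : target ≫ label = B.label ≫ X.out i j

/-- A simulation (special 2-cell) between two cobordisms with the same borders. -/
structure Simulation [HasPushouts S] {J : Type w} {X : Opcategory S J} {i j : J}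
    {A : Game X i} {B : Game X j} (σ τ : Cobordism A B) where
  hom : σ.support ⟶ τ.support
  source_hom : σ.source ≫ hom = τ.source
  target_hom : σ.target ≫ hom = τ.target
  hom_label : hom ≫ τ.label = σ.label

/-- Sequential composition: gluing by pushout, then relabeling along the multiplication. -/
noncomputable abbrev Cobordism.comp [HasPushouts S] {J : Type w} {X : Opcategory S J} {i j k : J}
    {A : Game X i} {B : Game X j} {C : Game X k} (σ : Cobordism A B) (τ : Cobordism B C) :
    Cobordism A C where
  support := pushout σ.target τ.source
  source := σ.source ≫ pushout.inl _ _
  target := τ.target ≫ pushout.inr _ _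
  label :=
    pushout.map σ.target τ.source (X.out i j) (X.inp j k) σ.label τ.label B.label
      σ.target_label τ.source_label ≫ X.mu i j k
  source_label := by
    simp [pushout.inl_desc_assoc, reassoc_of% σ.source_label, X.inp_mu]
  target_label := by
    simp [pushout.inr_desc_assoc, reassoc_of% τ.target_label, X.out_mu]

/-- The pointwise product of games, a game over the product opcategory. -/
noncomputable abbrev Game.prod [HasPushouts S] [HasBinaryProducts S] {J J' : Type w}
    {X : Opcategory S J} {Y : Opcategory S J'} {i : J} {i' : J'} (A : Game X i) (B : Game Y i') :
    Game (X.prod Y) (i, i') where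
  carrier := A.carrier ⨯ B.carrier
  label := Limits.prod.map A.label B.label

/-- The pointwise product of cobordisms. -/
noncomputable abbrev Cobordism.prod [HasPushouts S] [HasBinaryProducts S] {J J' : Type w}
    {X : Opcategory S J} {Y : Opcategory S J'} {i j : J} {i' j' : J'}
    {A : Game X i} {B : Game X j} {A' : Game Y i'} {B' : Game Y j'}
    (σ : Cobordism A B) (τ : Cobordism A' B') : Cobordism (A.prod A') (B.prod B') where
  support := σ.support ⨯ τ.support
  source := Limits.prod.map σ.source τ.source
  target := Limits.prod.map σ.target τ.target
  label := Limits.prod.map σ.label τ.label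
  source_label := by
    simp [Game.prod, Opcategory.prod, prod.map_map, σ.source_label, τ.source_label]
  target_label := by
    simp [Game.prod, Opcategory.prod, prod.map_map, σ.target_label, τ.target_label]

/-- Pulling a game along a plain internal functor. -/
noncomputable abbrev Game.pull [HasPushouts S] [HasPullbacks S] {J : Type w}
    {X Y : Opcategory S J} (F : PlainFunctor X Y) {i : J} (A : Game Y i) : Game X i where
  carrier := pullback A.label (F.map0 i)
  label := pullback.snd _ _

/-- Pulling a cobordism along a plain internal functor: pointwise pullbacks. -/
noncomputable abbrev Cobordism.pull [HasPushouts S] [HasPullbacks S] {J : Type w}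
    {X Y : Opcategory S J} (F : PlainFunctor X Y) {i j : J} {A : Game Y i} {B : Game Y j}
    (σ : Cobordism A B) : Cobordism (A.pull F) (B.pull F) where
  support := pullback σ.label (F.map1 i j)
  source := pullback.map _ _ _ _ σ.source (X.inp i j) (Y.inp i j)
    σ.source_label.symm (F.inp_map i j).symm
  target := pullback.map _ _ _ _ σ.target (X.out i j) (Y.out i j)
    σ.target_label.symm (F.out_map i j).symm
  label := pullback.snd _ _
  source_label := by simp [Game.pull, pullback.lift_snd]
  target_label := by simp [Game.pull, pullback.lift_snd]

/-- Pushing a game along an internal functor: relabeling. -/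
abbrev Game.push [HasPushouts S] {J J' : Type w} {f : J → J'} {X : Opcategory S J}
    {Y : Opcategory S J'} (F : InternalFunctor f X Y) {i : J} (A : Game X i) : Game Y (f i) where
  carrier := A.carrier
  label := A.label ≫ F.map0 i

/-- Pushing a cobordism along an internal functor: relabeling. -/
abbrev Cobordism.push [HasPushouts S] {J J' : Type w} {f : J → J'} {X : Opcategory S J}
    {Y : Opcategory S J'} (F : InternalFunctor f X Y) {i j : J} {A : Game X i} {B : Game X j}
    (σ : Cobordism A B) : Cobordism (A.push F) (B.push F) where
  support := σ.support
  source := σ.source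
  target := σ.target
  label := σ.label ≫ F.map1 i j
  source_label := by
    simp [Game.push, reassoc_of% σ.source_label, F.inp_map]
  target_label := by
    simp [Game.push, reassoc_of% σ.target_label, F.out_map]

section Parallel

variable [HasPushouts S] [HasPullbacks S] [HasBinaryProducts S] {J : Type w}
  {X : Opcategory S J}

/-- The parallel product of games: pull the product along `pick`, then push along `pince`. -/
noncomputable abbrev Game.par (P : AcuteSpan (X.prod X) X) {i i' : J} (A : Game X i)
    (A' : Game X i') : Game X (P.color (i, i')) :=
  ((A.prod A').pull P.left).push P.right

/-- The parallel product of cobordisms. -/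
noncomputable abbrev Cobordism.par (P : AcuteSpan (X.prod X) X) {i i' j j' : J} {A : Game X i}
    {B : Game X j} {A' : Game X i'} {B' : Game X j'} (σ : Cobordism A B) (τ : Cobordism A' B') :
    Cobordism (A.par P A') (B.par P B') :=
  ((σ.prod τ).pull P.left).push P.right

end Parallel

/-- A filling system over `X`: a cobordism between any two games. -/
structure FillingSystem [HasPushouts S] {J : Type w} (X : Opcategory S J) where
  fill : ∀ {i j : J} (A : Game X i) (B : Game X j), Cobordism A B

/-- Generalized sequential composition, through the filling cobordism. -/
noncomputable abbrev FillingSystem.seq [HasPushouts S] {J : Type w} {X : Opcategory S J}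
    (F : FillingSystem X) {i j j' k : J} {A : Game X i} {B : Game X j} {B' : Game X j'}
    {C : Game X k} (σ : Cobordism A B) (τ : Cobordism B' C) : Cobordism A C :=
  (σ.comp (F.fill B B')).comp τ

/-- The canonical filling: the pushout of the two games above their pullback over `X.obj1 i j`. -/
noncomputable abbrev FillingSystem.canonical [HasPushouts S] [HasPullbacks S] {J : Type w}
    (X : Opcategory S J) : FillingSystem X where
  fill {i j} A B :=
    { support := pushout (pullback.fst (A.label ≫ X.inp i j) (B.label ≫ X.out i j))
        (pullback.snd (A.label ≫ X.inp i j) (B.label ≫ X.out i j))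
      source := pushout.inl _ _
      target := pushout.inr _ _
      label := pushout.desc (A.label ≫ X.inp i j) (B.label ≫ X.out i j) pullback.condition
      source_label := pushout.inl_desc _ _ _
      target_label := pushout.inr_desc _ _ _ }

/-- For all games there is a map from the filling between parallel products to the parallel
product of the fillings. -/
def FillingSystem.MapsToParallel [HasPushouts S] [HasPullbacks S] [HasBinaryProducts S]
    {J : Type w} {X : Opcategory S J} (F : FillingSystem X) (P : AcuteSpan (X.prod X) X) : Prop :=
  ∀ {i i' j j' : J} (A : Game X i) (A' : Game X i') (B : Game X j) (B' : Game X j'),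
    Nonempty (Simulation (F.fill (A.par P A') (B.par P B'))
      ((F.fill A B).par P (F.fill A' B')))

end Cobordisms

section AsynchronousGraphs

/-- Asynchronous graphs. A tile `x` is mapped to the square formed by the two paths
`p₁ x · p₂ x` and `q₁ x · q₂ x` of length two with the same source and target; the symmetry
exchanges these two paths. -/
structure AGraph where
  V : Type t
  E : Type t
  T : Type t
  src : E → V
  tgt : E → V
  p₁ : T → E
  p₂ : T → E
  q₁ : T → E
  q₂ : T → E
  sym : T → T
  src_eq : ∀ x, src (p₁ x) = src (q₁ x)
  p_comp : ∀ x, tgt (p₁ x) = src (p₂ x)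
  q_comp : ∀ x, tgt (q₁ x) = src (q₂ x)
  tgt_eq : ∀ x, tgt (p₂ x) = tgt (q₂ x)
  p₁_sym : ∀ x, p₁ (sym x) = q₁ x
  p₂_sym : ∀ x, p₂ (sym x) = q₂ x
  q₁_sym : ∀ x, q₁ (sym x) = p₁ x
  q₂_sym : ∀ x, q₂ (sym x) = p₂ x

/-- Asynchronous morphisms. -/
@[ext]
structure AGraph.Hom (G H : AGraph.{t}) where
  v : G.V → H.V
  e : G.E → H.E
  t : G.T → H.T
  src : ∀ a, v (G.src a) = H.src (e a)
  tgt : ∀ a, v (G.tgt a) = H.tgt (e a)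
  p₁ : ∀ x, e (G.p₁ x) = H.p₁ (t x)
  p₂ : ∀ x, e (G.p₂ x) = H.p₂ (t x)
  q₁ : ∀ x, e (G.q₁ x) = H.q₁ (t x)
  q₂ : ∀ x, e (G.q₂ x) = H.q₂ (t x)
  sym : ∀ x, t (G.sym x) = H.sym (t x)

instance : Category AGraph.{t} where
  Hom := AGraph.Hom
  id G :=
    { v := id, e := id, t := id, src := fun _ => rfl, tgt := fun _ => rfl, p₁ := fun _ => rfl,
      p₂ := fun _ => rfl, q₁ := fun _ => rfl, q₂ := fun _ => rfl, sym := fun _ => rfl }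
  comp f g :=
    { v := g.v ∘ f.v, e := g.e ∘ f.e, t := g.t ∘ f.t,
      src := fun a => by simp [f.src, g.src], tgt := fun a => by simp [f.tgt, g.tgt],
      p₁ := fun a => by simp [f.p₁, g.p₁], p₂ := fun a => by simp [f.p₂, g.p₂],
      q₁ := fun a => by simp [f.q₁, g.q₁], q₂ := fun a => by simp [f.q₂, g.q₂],
      sym := fun a => by simp [f.sym, g.sym] }

namespace AGraph

@[ext]
theorem hom_ext {G H : AGraph.{t}} (f g : G ⟶ H) (hv : Hom.v f = Hom.v g)
    (he : Hom.e f = Hom.e g) (ht : Hom.t f = Hom.t g) : f = g :=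
  Hom.ext hv he ht

section Limits

variable {J : Type} [SmallCategory J] (F : J ⥤ AGraph.{t})

/-- The pointwise limit: compatible families of nodes, of edges and of tiles. -/
def limitGraph : AGraph.{t} where
  V := { x : ∀ j, (F.obj j).V // ∀ {i j} (f : i ⟶ j), Hom.v (F.map f) (x i) = x j }
  E := { x : ∀ j, (F.obj j).E // ∀ {i j} (f : i ⟶ j), Hom.e (F.map f) (x i) = x j }
  T := { x : ∀ j, (F.obj j).T // ∀ {i j} (f : i ⟶ j), Hom.t (F.map f) (x i) = x j }
  src x := ⟨fun j => (F.obj j).src (x.1 j), fun f => by rw [Hom.src, x.2 f]⟩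
  tgt x := ⟨fun j => (F.obj j).tgt (x.1 j), fun f => by rw [Hom.tgt, x.2 f]⟩
  p₁ x := ⟨fun j => (F.obj j).p₁ (x.1 j), fun f => by rw [Hom.p₁, x.2 f]⟩
  p₂ x := ⟨fun j => (F.obj j).p₂ (x.1 j), fun f => by rw [Hom.p₂, x.2 f]⟩
  q₁ x := ⟨fun j => (F.obj j).q₁ (x.1 j), fun f => by rw [Hom.q₁, x.2 f]⟩
  q₂ x := ⟨fun j => (F.obj j).q₂ (x.1 j), fun f => by rw [Hom.q₂, x.2 f]⟩
  sym x := ⟨fun j => (F.obj j).sym (x.1 j), fun f => by rw [Hom.sym, x.2 f]⟩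
  src_eq x := Subtype.ext (funext fun j => (F.obj j).src_eq (x.1 j))
  p_comp x := Subtype.ext (funext fun j => (F.obj j).p_comp (x.1 j))
  q_comp x := Subtype.ext (funext fun j => (F.obj j).q_comp (x.1 j))
  tgt_eq x := Subtype.ext (funext fun j => (F.obj j).tgt_eq (x.1 j))
  p₁_sym x := Subtype.ext (funext fun j => (F.obj j).p₁_sym (x.1 j))
  p₂_sym x := Subtype.ext (funext fun j => (F.obj j).p₂_sym (x.1 j))
  q₁_sym x := Subtype.ext (funext fun j => (F.obj j).q₁_sym (x.1 j))
  q₂_sym x := Subtype.ext (funext fun j => (F.obj j).q₂_sym (x.1 j))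

def limitProj (j : J) : Hom (limitGraph F) (F.obj j) where
  v x := x.1 j
  e x := x.1 j
  t x := x.1 j
  src _ := rfl
  tgt _ := rfl
  p₁ _ := rfl
  p₂ _ := rfl
  q₁ _ := rfl
  q₂ _ := rfl
  sym _ := rfl

def limitCone : Cone F where
  pt := limitGraph F
  π :=
    { app := fun j => limitProj F j
      naturality := fun i j f => by
        refine hom_ext _ _ ?_ ?_ ?_ <;> funext x <;> exact (x.2 f).symm }

def limitLift (s : Cone F) : Hom s.pt (limitGraph F) where
  v x := ⟨fun j => Hom.v (s.π.app j) x, fun f => congrFun (congrArg Hom.v (s.w f)) x⟩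
  e x := ⟨fun j => Hom.e (s.π.app j) x, fun f => congrFun (congrArg Hom.e (s.w f)) x⟩
  t x := ⟨fun j => Hom.t (s.π.app j) x, fun f => congrFun (congrArg Hom.t (s.w f)) x⟩
  src x := Subtype.ext (funext fun j => Hom.src (s.π.app j) x)
  tgt x := Subtype.ext (funext fun j => Hom.tgt (s.π.app j) x)
  p₁ x := Subtype.ext (funext fun j => Hom.p₁ (s.π.app j) x)
  p₂ x := Subtype.ext (funext fun j => Hom.p₂ (s.π.app j) x)
  q₁ x := Subtype.ext (funext fun j => Hom.q₁ (s.π.app j) x)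
  q₂ x := Subtype.ext (funext fun j => Hom.q₂ (s.π.app j) x)
  sym x := Subtype.ext (funext fun j => Hom.sym (s.π.app j) x)

def limitConeIsLimit : IsLimit (limitCone F) where
  lift s := limitLift F s
  fac _ _ := rfl
  uniq s m h := by
    refine hom_ext _ _ ?_ ?_ ?_ <;> funext x <;> apply Subtype.ext <;> funext j
    · exact congrFun (congrArg Hom.v (h j)) x
    · exact congrFun (congrArg Hom.e (h j)) x
    · exact congrFun (congrArg Hom.t (h j)) x

instance : HasLimitsOfShape J AGraph.{t} where
  has_limit F := ⟨⟨⟨limitCone F, limitConeIsLimit F⟩⟩⟩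

/-- The pointwise colimit: quotients of the disjoint unions of nodes, of edges and of tiles. -/
def colimitGraph : AGraph.{t} where
  V := Quot fun x y : (Σ j, (F.obj j).V) => ∃ f : x.1 ⟶ y.1, y.2 = Hom.v (F.map f) x.2
  E := Quot fun x y : (Σ j, (F.obj j).E) => ∃ f : x.1 ⟶ y.1, y.2 = Hom.e (F.map f) x.2
  T := Quot fun x y : (Σ j, (F.obj j).T) => ∃ f : x.1 ⟶ y.1, y.2 = Hom.t (F.map f) x.2
  src := Quot.map (fun x => ⟨x.1, (F.obj x.1).src x.2⟩)
    fun x y ⟨f, h⟩ => ⟨f, by simp only [h, Hom.src]⟩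
  tgt := Quot.map (fun x => ⟨x.1, (F.obj x.1).tgt x.2⟩)
    fun x y ⟨f, h⟩ => ⟨f, by simp only [h, Hom.tgt]⟩
  p₁ := Quot.map (fun x => ⟨x.1, (F.obj x.1).p₁ x.2⟩)
    fun x y ⟨f, h⟩ => ⟨f, by simp only [h, Hom.p₁]⟩
  p₂ := Quot.map (fun x => ⟨x.1, (F.obj x.1).p₂ x.2⟩)
    fun x y ⟨f, h⟩ => ⟨f, by simp only [h, Hom.p₂]⟩
  q₁ := Quot.map (fun x => ⟨x.1, (F.obj x.1).q₁ x.2⟩)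
    fun x y ⟨f, h⟩ => ⟨f, by simp only [h, Hom.q₁]⟩
  q₂ := Quot.map (fun x => ⟨x.1, (F.obj x.1).q₂ x.2⟩)
    fun x y ⟨f, h⟩ => ⟨f, by simp only [h, Hom.q₂]⟩
  sym := Quot.map (fun x => ⟨x.1, (F.obj x.1).sym x.2⟩)
    fun x y ⟨f, h⟩ => ⟨f, by simp only [h, Hom.sym]⟩
  src_eq := by rintro ⟨x⟩; simp only [Quot.map, AGraph.src_eq]
  p_comp := by rintro ⟨x⟩; simp only [Quot.map, AGraph.p_comp]
  q_comp := by rintro ⟨x⟩; simp only [Quot.map, AGraph.q_comp]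
  tgt_eq := by rintro ⟨x⟩; simp only [Quot.map, AGraph.tgt_eq]
  p₁_sym := by rintro ⟨x⟩; simp only [Quot.map, AGraph.p₁_sym]
  p₂_sym := by rintro ⟨x⟩; simp only [Quot.map, AGraph.p₂_sym]
  q₁_sym := by rintro ⟨x⟩; simp only [Quot.map, AGraph.q₁_sym]
  q₂_sym := by rintro ⟨x⟩; simp only [Quot.map, AGraph.q₂_sym]

def colimitInj (j : J) : Hom (F.obj j) (colimitGraph F) where
  v x := Quot.mk _ ⟨j, x⟩
  e x := Quot.mk _ ⟨j, x⟩
  t x := Quot.mk _ ⟨j, x⟩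
  src _ := rfl
  tgt _ := rfl
  p₁ _ := rfl
  p₂ _ := rfl
  q₁ _ := rfl
  q₂ _ := rfl
  sym _ := rfl

def colimitCocone : Cocone F where
  pt := colimitGraph F
  ι :=
    { app := fun j => colimitInj F j
      naturality := fun i j f => by
        refine hom_ext _ _ ?_ ?_ ?_ <;> funext x <;> exact (Quot.sound ⟨f, rfl⟩).symm }

def colimitDesc (s : Cocone F) : Hom (colimitGraph F) s.pt where
  v := Quot.lift (fun x => Hom.v (s.ι.app x.1) x.2) fun x y ⟨f, h⟩ => by
    rw [h]; exact (congrFun (congrArg Hom.v (s.w f)) x.2).symm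
  e := Quot.lift (fun x => Hom.e (s.ι.app x.1) x.2) fun x y ⟨f, h⟩ => by
    rw [h]; exact (congrFun (congrArg Hom.e (s.w f)) x.2).symm
  t := Quot.lift (fun x => Hom.t (s.ι.app x.1) x.2) fun x y ⟨f, h⟩ => by
    rw [h]; exact (congrFun (congrArg Hom.t (s.w f)) x.2).symm
  src := by rintro ⟨x⟩; exact Hom.src (s.ι.app x.1) x.2
  tgt := by rintro ⟨x⟩; exact Hom.tgt (s.ι.app x.1) x.2
  p₁ := by rintro ⟨x⟩; exact Hom.p₁ (s.ι.app x.1) x.2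
  p₂ := by rintro ⟨x⟩; exact Hom.p₂ (s.ι.app x.1) x.2
  q₁ := by rintro ⟨x⟩; exact Hom.q₁ (s.ι.app x.1) x.2
  q₂ := by rintro ⟨x⟩; exact Hom.q₂ (s.ι.app x.1) x.2
  sym := by rintro ⟨x⟩; exact Hom.sym (s.ι.app x.1) x.2

def colimitCoconeIsColimit : IsColimit (colimitCocone F) where
  desc s := colimitDesc F s
  fac _ _ := rfl
  uniq s m h := by
    refine hom_ext _ _ ?_ ?_ ?_ <;> funext x <;> obtain ⟨j, x⟩ := x
    · exact congrFun (congrArg Hom.v (h j)) x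
    · exact congrFun (congrArg Hom.e (h j)) x
    · exact congrFun (congrArg Hom.t (h j)) x

instance : HasColimitsOfShape J AGraph.{t} where
  has_colimit F := ⟨⟨⟨colimitCocone F, colimitCoconeIsColimit F⟩⟩⟩

end Limits

/-- The functor `Ω`, on objects: one node, the labels as edges, and one tile for each square. -/
def Omega (L : Type t) : AGraph.{t} where
  V := PUnit
  E := L
  T := (L × L) × (L × L)
  src _ := PUnit.unit
  tgt _ := PUnit.unit
  p₁ x := x.1.1
  p₂ x := x.1.2
  q₁ x := x.2.1
  q₂ x := x.2.2
  sym x := (x.2, x.1)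
  src_eq _ := rfl
  p_comp _ := rfl
  q_comp _ := rfl
  tgt_eq _ := rfl
  p₁_sym _ := rfl
  p₂_sym _ := rfl
  q₁_sym _ := rfl
  q₂_sym _ := rfl

/-- The functor `Ω`, on maps. -/
def Omega.map {L L' : Type t} (f : L → L') : Omega L ⟶ Omega L' :=
  { v := id
    e := f
    t := Prod.map (Prod.map f f) (Prod.map f f)
    src := fun _ => rfl
    tgt := fun _ => rfl
    p₁ := fun _ => rfl
    p₂ := fun _ => rfl
    q₁ := fun _ => rfl
    q₂ := fun _ => rfl
    sym := fun _ => rfl : Hom (Omega L) (Omega L') }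

/-- The morphism to `Ω L` that gives all edges the label `l`. -/
def Omega.const (G : AGraph.{t}) {L : Type t} (l : L) : G ⟶ Omega L :=
  { v := fun _ => PUnit.unit
    e := fun _ => l
    t := fun _ => ((l, l), (l, l))
    src := fun _ => rfl
    tgt := fun _ => rfl
    p₁ := fun _ => rfl
    p₂ := fun _ => rfl
    q₁ := fun _ => rfl
    q₂ := fun _ => rfl
    sym := fun _ => rfl : Hom G (Omega L) }

end AGraph

/-- The polarities Code and Frame. -/
inductive Pol₂ : Type t
  | C
  | F

/-- The polarities of two Codes and a Frame. -/
inductive Pol₃ : Type t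
  | C₁
  | C₂
  | F

namespace Pol₃

/-- `(12)(F)`: both codes become the Code. -/
def merge : Pol₃.{t} → Pol₂.{t}
  | C₁ => .C
  | C₂ => .C
  | F => .F

/-- `(1)(2F)`: the second code is part of the Frame of the first. -/
def first : Pol₃.{t} → Pol₂.{t}
  | C₁ => .C
  | C₂ => .F
  | F => .F

/-- `(2)(1F)`: the first code is part of the Frame of the second. -/
def second : Pol₃.{t} → Pol₂.{t}
  | C₁ => .F
  | C₂ => .C
  | F => .F

end Pol₃

namespace AGraph

variable (M : AGraph.{t})

/-- The two-player version of a machine model. -/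
noncomputable abbrev twoPlayer : AGraph.{t} := M ⨯ Omega Pol₂.{t}

/-- The embedding of the one-player model, with the polarity of the Frame. -/
noncomputable def frame : M ⟶ M.twoPlayer := prod.lift (𝟙 M) (Omega.const M Pol₂.F)

/-- The template of a machine model: the internal opcategory (with one color) whose cospan
consists of two copies of `frame`. -/
noncomputable abbrev template : Opcategory AGraph.{t} PUnit.{t + 1} := Opcategory.ofMap _ M.frame

/-- The three-player version of a machine model. -/
noncomputable abbrev threePlayer : AGraph.{t} :=
  pullback (prod.snd : M.twoPlayer ⟶ Omega Pol₂.{t}) (Omega.map Pol₃.merge)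

/-- The map from the three-player to the two-player model that keeps the underlying machine
transitions and changes the polarities by `f`. -/
noncomputable def relabel (f : Pol₃.{t} → Pol₂.{t}) : M.threePlayer ⟶ M.twoPlayer :=
  prod.lift (pullback.fst _ _ ≫ prod.fst) (pullback.snd _ _ ≫ Omega.map f)

theorem frame_snd : M.frame ≫ prod.snd = Omega.const M Pol₃.F ≫ Omega.map Pol₃.merge := by
  simp only [frame, prod.lift_snd]
  rfl

/-- The embedding of the one-player model in the three-player model, with the polarity of the
Frame. -/
noncomputable def frame₃ : M ⟶ M.threePlayer :=
  pullback.lift M.frame (Omega.const M Pol₃.F) M.frame_snd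

theorem frame₃_relabel (f : Pol₃.{t} → Pol₂.{t}) (hf : f Pol₃.F = Pol₂.F) :
    M.frame₃ ≫ M.relabel f = 𝟙 M ≫ M.frame := by
  have h : Omega.const M Pol₃.F ≫ Omega.map f = Omega.const M Pol₂.F := by
    rw [← hf]; rfl
  simp only [relabel, frame₃, prod.comp_lift, pullback.lift_fst_assoc, pullback.lift_snd_assoc, h,
    Category.id_comp]
  simp only [frame, prod.lift_fst]

/-- The acute span that defines the parallel product over the template of a machine model: its
apex is the three-player opcategory, `pick` lets each of the two codes see the other one as part
of its Frame, and `pince` merges the two codes. -/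
noncomputable abbrev parallel : AcuteSpan (M.template.prod M.template) M.template where
  apex := Opcategory.ofMap _ M.frame₃
  left := InternalFunctor.pair
    (InternalFunctor.ofSquare Prod.fst (𝟙 M) (M.relabel Pol₃.first) (M.frame₃_relabel _ rfl))
    (InternalFunctor.ofSquare Prod.snd (𝟙 M) (M.relabel Pol₃.second) (M.frame₃_relabel _ rfl))
  color _ := PUnit.unit
  right := InternalFunctor.ofSquare _ (𝟙 M) (pullback.fst _ _) (by
    rw [frame₃, pullback.lift_fst, Category.id_comp])

end AGraph

/-- The asynchronous graph of a transition system with states `State`, an additional node `none`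
for the error, and an edge for each transition `s --m--> n`. There is one tile for each square
formed by two paths `s --m--> s₁ --m'--> n` and `s --m'--> s₂ --m--> n` such that `m` and `m'` are
independent. -/
def machineGraph {State Instr : Type t} (Step : State → Instr → Option State → Prop)
    (Indep : State → Instr → Instr → Prop)
    (indep_symm : ∀ s m m', Indep s m m' → Indep s m' m) : AGraph.{t} where
  V := Option State
  E := { a : State × Instr × Option State // Step a.1 a.2.1 a.2.2 }
  T := { x : ({ a : State × Instr × Option State // Step a.1 a.2.1 a.2.2 } ×
        { a : State × Instr × Option State // Step a.1 a.2.1 a.2.2 }) ×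
      ({ a : State × Instr × Option State // Step a.1 a.2.1 a.2.2 } ×
        { a : State × Instr × Option State // Step a.1 a.2.1 a.2.2 }) //
      x.1.1.1.1 = x.2.1.1.1 ∧
      x.1.1.1.2.2 = some x.1.2.1.1 ∧
      x.2.1.1.2.2 = some x.2.2.1.1 ∧
      x.1.2.1.2.2 = x.2.2.1.2.2 ∧
      x.1.1.1.2.1 = x.2.2.1.2.1 ∧
      x.2.1.1.2.1 = x.1.2.1.2.1 ∧
      Indep x.1.1.1.1 x.1.1.1.2.1 x.2.1.1.2.1 }
  src a := some a.1.1
  tgt a := a.1.2.2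
  p₁ x := x.1.1.1
  p₂ x := x.1.1.2
  q₁ x := x.1.2.1
  q₂ x := x.1.2.2
  sym x := ⟨(x.1.2, x.1.1), x.2.1.symm, x.2.2.2.1, x.2.2.1, x.2.2.2.2.1.symm, x.2.2.2.2.2.2.1,
    x.2.2.2.2.2.1, by
      obtain ⟨x, h₁, h₂, h₃, h₄, h₅, h₆, h₇⟩ := x
      change Indep x.2.1.1.1 x.2.1.1.2.1 x.1.1.1.2.1
      rw [← h₁]
      exact indep_symm _ _ _ h₇⟩
  src_eq x := congrArg some x.2.1
  p_comp x := x.2.2.1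
  q_comp x := x.2.2.2.1
  tgt_eq x := x.2.2.2.2.1
  p₁_sym _ := rfl
  p₂_sym _ := rfl
  q₁_sym _ := rfl
  q₂_sym _ := rfl

/-- Finite partial maps. -/
structure FinMap (α β : Type t) where
  get : α → Option β
  finite : { a | get a ≠ none }.Finite

open Classical in
/-- Change the value at `a`; `none` removes `a` from the domain. -/
noncomputable def FinMap.set {α β : Type t} (f : FinMap α β) (a : α) (o : Option β) :
    FinMap α β where
  get := Function.update f.get a o
  finite := (f.finite.insert a).subset fun b hb => by
    by_cases h : b = a
    · exact Or.inl h
    · refine Or.inr ?_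
      simpa [Function.update_of_ne h] using hb

/-- The parameters of the machine: variables, values, locations among the values (with
`ℕ ⊆ Loc ⊆ Val`), locks, and the partial operations and tests on values that arithmetic and
boolean expressions may use. -/
structure Signature where
  Var : Type t
  Val : Type t
  Lock : Type t
  Loc : Set Val
  nat : ℕ ↪ Val
  nat_mem : ∀ n, nat n ∈ Loc
  Op : Type t
  op : Op → Val → Val → Option Val
  Rel : Type t
  rel : Rel → Val → Val → Option Bool

/-- Arithmetic expressions. -/
inductive Expr (Γ : Signature.{t}) : Type t
  | var (x : Γ.Var)
  | const (c : Γ.Val)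
  | op (o : Γ.Op) (E E' : Expr Γ)

/-- Boolean expressions. -/
inductive BExpr (Γ : Signature.{t}) : Type t
  | rel (r : Γ.Rel) (E E' : Expr Γ)
  | not (B : BExpr Γ)
  | and (B B' : BExpr Γ)

namespace Expr

variable {Γ : Signature.{t}}

def eval (s : FinMap Γ.Var Γ.Val) : Expr Γ → Option Γ.Val
  | var x => s.get x
  | const c => some c
  | op o E E' => (E.eval s).bind fun a => (E'.eval s).bind fun b => Γ.op o a b

def vars : Expr Γ → Set Γ.Var
  | var x => {x}
  | const _ => ∅
  | op _ E E' => E.vars ∪ E'.vars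

end Expr

namespace BExpr

variable {Γ : Signature.{t}}

def eval (s : FinMap Γ.Var Γ.Val) : BExpr Γ → Option Bool
  | rel r E E' => (E.eval s).bind fun a => (E'.eval s).bind fun b => Γ.rel r a b
  | not B => (B.eval s).map Bool.not
  | and B B' => (B.eval s).bind fun a => (B'.eval s).map fun b => a && b

def vars : BExpr Γ → Set Γ.Var
  | rel _ E E' => E.vars ∪ E'.vars
  | not B => B.vars
  | and B B' => B.vars ∪ B'.vars

end BExpr

/-- Machine states: a stack, a heap and a set of locks. -/
structure MState (Γ : Signature.{t}) : Type t where
  stack : FinMap Γ.Var Γ.Val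
  heap : FinMap Γ.Loc Γ.Val
  locks : Set Γ.Lock

/-- Machine instructions: `x := E`, `x := [E]`, `[E] := E'`, `test(B)`, `nop`, `x := alloc(E, ℓ)`,
`dispose(E)`, `P(r)` and `V(r)`. -/
inductive Instr (Γ : Signature.{t}) : Type t
  | assign (x : Γ.Var) (E : Expr Γ)
  | load (x : Γ.Var) (E : Expr Γ)
  | store (E E' : Expr Γ)
  | test (B : BExpr Γ)
  | nop
  | alloc (x : Γ.Var) (E : Expr Γ) (l : Γ.Loc)
  | dispose (E : Expr Γ)
  | acquire (r : Γ.Lock)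
  | release (r : Γ.Lock)

/-- The transitions of the stateful machine; `none` is the error. -/
inductive Step {Γ : Signature.{t}} : MState Γ → Instr Γ → Option (MState Γ) → Prop
  | assign (μ : MState Γ) (x : Γ.Var) (E : Expr Γ) (a : Γ.Val) (hE : E.eval μ.stack = some a) :
      Step μ (.assign x E) (some { μ with stack := μ.stack.set x (some a) })
  | assign_error (μ : MState Γ) (x : Γ.Var) (E : Expr Γ) (hE : E.eval μ.stack = none) :
      Step μ (.assign x E) none
  | load (μ : MState Γ) (x : Γ.Var) (E : Expr Γ) (l : Γ.Loc) (a : Γ.Val)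
      (hE : E.eval μ.stack = some l.1) (hl : μ.heap.get l = some a) :
      Step μ (.load x E) (some { μ with stack := μ.stack.set x (some a) })
  | load_error (μ : MState Γ) (x : Γ.Var) (E : Expr Γ)
      (h : ¬∃ l : Γ.Loc, E.eval μ.stack = some l.1 ∧ μ.heap.get l ≠ none) :
      Step μ (.load x E) none
  | store (μ : MState Γ) (E E' : Expr Γ) (l : Γ.Loc) (a : Γ.Val)
      (hE : E.eval μ.stack = some l.1) (hl : μ.heap.get l ≠ none)
      (hE' : E'.eval μ.stack = some a) :
      Step μ (.store E E') (some { μ with heap := μ.heap.set l (some a) })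
  | store_error (μ : MState Γ) (E E' : Expr Γ)
      (h : (¬∃ l : Γ.Loc, E.eval μ.stack = some l.1 ∧ μ.heap.get l ≠ none) ∨
        E'.eval μ.stack = none) :
      Step μ (.store E E') none
  | test (μ : MState Γ) (B : BExpr Γ) (hB : B.eval μ.stack = some true) :
      Step μ (.test B) (some μ)
  | nop (μ : MState Γ) : Step μ .nop (some μ)
  | alloc (μ : MState Γ) (x : Γ.Var) (E : Expr Γ) (l : Γ.Loc) (a : Γ.Val)
      (hl : μ.heap.get l = none) (hE : E.eval μ.stack = some a) :
      Step μ (.alloc x E l)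
        (some { μ with stack := μ.stack.set x (some l.1), heap := μ.heap.set l (some a) })
  | alloc_error (μ : MState Γ) (x : Γ.Var) (E : Expr Γ) (l : Γ.Loc)
      (hl : μ.heap.get l = none) (hE : E.eval μ.stack = none) : Step μ (.alloc x E l) none
  | dispose (μ : MState Γ) (E : Expr Γ) (l : Γ.Loc) (hE : E.eval μ.stack = some l.1)
      (hl : μ.heap.get l ≠ none) :
      Step μ (.dispose E) (some { μ with heap := μ.heap.set l none })
  | dispose_error (μ : MState Γ) (E : Expr Γ)
      (h : ¬∃ l : Γ.Loc, E.eval μ.stack = some l.1 ∧ μ.heap.get l ≠ none) :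
      Step μ (.dispose E) none
  | acquire (μ : MState Γ) (r : Γ.Lock) (hr : r ∉ μ.locks) :
      Step μ (.acquire r) (some { μ with locks := insert r μ.locks })
  | release (μ : MState Γ) (r : Γ.Lock) (hr : r ∈ μ.locks) :
      Step μ (.release r) (some { μ with locks := μ.locks \ {r} })

/-- Machine state footprints: the variables and locations read and written, the locks touched, and
the locations allocated or deallocated. -/
structure Footprint (Γ : Signature.{t}) where
  rd : Set (Γ.Var ⊕ Γ.Loc)
  wr : Set (Γ.Var ⊕ Γ.Loc)
  lock : Set Γ.Lock
  mem : Set Γ.Loc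

/-- Independence of footprints. -/
def Footprint.Indep {Γ : Signature.{t}} (ρ ρ' : Footprint Γ) : Prop :=
  (ρ.rd ∪ ρ.wr) ∩ ρ'.wr = ∅ ∧ (ρ'.rd ∪ ρ'.wr) ∩ ρ.wr = ∅ ∧
    ρ.lock ∩ ρ'.lock = ∅ ∧ ρ.mem ∩ ρ'.mem = ∅

theorem Footprint.Indep.symm {Γ : Signature.{t}} {ρ ρ' : Footprint Γ} (h : ρ.Indep ρ') :
    ρ'.Indep ρ :=
  ⟨h.2.1, h.1, by rw [Set.inter_comm]; exact h.2.2.1, by rw [Set.inter_comm]; exact h.2.2.2⟩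

/-- The location denoted by an expression, if any. -/
def Expr.addr {Γ : Signature.{t}} (s : FinMap Γ.Var Γ.Val) (E : Expr Γ) : Set Γ.Loc :=
  { l | E.eval s = some l.1 }

/-- The footprint of an instruction executed in a given state. -/
def Instr.footprint {Γ : Signature.{t}} (μ : MState Γ) : Instr Γ → Footprint Γ
  | assign x E => ⟨.inl '' E.vars, {.inl x}, ∅, ∅⟩
  | load x E => ⟨.inl '' E.vars ∪ .inr '' E.addr μ.stack, {.inl x}, ∅, ∅⟩
  | store E E' => ⟨.inl '' (E.vars ∪ E'.vars), .inr '' E.addr μ.stack, ∅, ∅⟩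
  | test B => ⟨.inl '' B.vars, ∅, ∅, ∅⟩
  | nop => ⟨∅, ∅, ∅, ∅⟩
  | alloc x E l => ⟨.inl '' E.vars, {.inl x, .inr l}, ∅, {l}⟩
  | dispose E => ⟨.inl '' E.vars, .inr '' E.addr μ.stack, ∅, E.addr μ.stack⟩
  | acquire r => ⟨∅, ∅, {r}, ∅⟩
  | release r => ⟨∅, ∅, {r}, ∅⟩

/-- The stateful machine model. -/
def statefulModel (Γ : Signature.{t}) : AGraph.{t} :=
  machineGraph (State := MState Γ) (Instr := Instr Γ) Step
    (fun μ m m' => (m.footprint μ).Indep (m'.footprint μ)) (fun _ _ _ h => h.symm)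

/-- Lock instructions: `P(r)`, `V(r)`, `alloc(ℓ)`, `dispose(ℓ)` and `τ`. -/
inductive LInstr (Γ : Signature.{t}) : Type t
  | acquire (r : Γ.Lock)
  | release (r : Γ.Lock)
  | alloc (l : Γ.Loc)
  | dispose (l : Γ.Loc)
  | tau

/-- The transitions of the stateless machine; `none` is the error. -/
inductive LStep {Γ : Signature.{t}} : Set Γ.Lock → LInstr Γ → Option (Set Γ.Lock) → Prop
  | acquire (L : Set Γ.Lock) (r : Γ.Lock) (hr : r ∉ L) : LStep L (.acquire r) (some (insert r L))
  | release (L : Set Γ.Lock) (r : Γ.Lock) (hr : r ∈ L) : LStep L (.release r) (some (L \ {r}))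
  | alloc (L : Set Γ.Lock) (l : Γ.Loc) : LStep L (.alloc l) (some L)
  | dispose (L : Set Γ.Lock) (l : Γ.Loc) : LStep L (.dispose l) (some L)
  | tau (L : Set Γ.Lock) : LStep L .tau (some L)
  | error (L : Set Γ.Lock) (m : LInstr Γ) : LStep L m none

/-- The locks of a lock footprint. -/
def LInstr.lock {Γ : Signature.{t}} : LInstr Γ → Set Γ.Lock
  | acquire r => {r}
  | release r => {r}
  | _ => ∅

/-- The locations of a lock footprint. -/
def LInstr.mem {Γ : Signature.{t}} : LInstr Γ → Set Γ.Loc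
  | alloc l => {l}
  | dispose l => {l}
  | _ => ∅

/-- The stateless machine model. -/
def statelessModel (Γ : Signature.{t}) : AGraph.{t} :=
  machineGraph (State := Set Γ.Lock) (Instr := LInstr Γ) LStep
    (fun _ m m' => Disjoint m.lock m'.lock ∧ Disjoint m.mem m'.mem)
    (fun _ _ _ h => ⟨h.1.symm, h.2.symm⟩)

end AsynchronousGraphs

end Cobord

open Cobord

/-! Both halves use universal properties only; no exactness of the ambient category is needed. For
(1), sequential composition is a pushout, while the parallel product is a pointwise product followed
by a pullback along `pick` and a relabeling along `pince`. A pushout always has a canonical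
comparison map into a limit of pushouts, and because `pick` and `pince` commute with the
multiplications this map respects labels. This is the lax interchange `compPar`, obtained from
`compProd`, `compPull` and `compPush`. The Hoare inequality `seqPar` replaces the filling between
the parallel products by the parallel product of the fillings, then interchanges twice, once for
each of the two compositions around the filling. For (2), a simulation from a canonical filling to a
cobordism `τ` with the same borders amounts to one equation: the two legs of `τ` agree on the
pullback of the border games over `X.obj1`. When `τ` is a parallel product of canonical fillings,
this equation has to be checked in the apex of the span and in each of the two fillings. The
difficulty is that `pince` forgets which code moved, so agreement in `X.obj1` need not imply
agreement in the apex. `canonical_mapsToParallel` isolates the missing implication, which is only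
required for maps that come from the borders. In the template of a machine model the borders carry
only Frame moves and `frame` is a split monomorphism, so the implication holds for every
asynchronous graph. -/

namespace Cobord

/-! ### Simulations and their compatibility with composition, relabeling, pullback and product -/

section Simulations

variable {S : Type u} [Category.{v} S] [HasPushouts S] {J J' : Type w}

attribute [local simp] pushout.inl_desc pushout.inl_desc_assoc pushout.inr_desc
  pushout.inr_desc_assoc pullback.lift_fst pullback.lift_fst_assoc pullback.lift_snd
  pullback.lift_snd_assoc

namespace Simulation

def refl {X : Opcategory S J} {i j : J} {A : Game X i} {B : Game X j} (σ : Cobordism A B) :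
    Simulation σ σ where
  hom := 𝟙 _
  source_hom := Category.comp_id _
  target_hom := Category.comp_id _
  hom_label := Category.id_comp _

def trans {X : Opcategory S J} {i j : J} {A : Game X i} {B : Game X j} {σ τ υ : Cobordism A B}
    (f : Simulation σ τ) (g : Simulation τ υ) : Simulation σ υ where
  hom := f.hom ≫ g.hom
  source_hom := by rw [reassoc_of% f.source_hom, g.source_hom]
  target_hom := by rw [reassoc_of% f.target_hom, g.target_hom]
  hom_label := by rw [Category.assoc, g.hom_label, f.hom_label]

/-- Sequential composition is functorial in simulations. -/
noncomputable def comp {X : Opcategory S J} {i j k : J} {A : Game X i} {B : Game X j}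
    {C : Game X k} {σ σ' : Cobordism A B} {τ τ' : Cobordism B C} (f : Simulation σ σ')
    (g : Simulation τ τ') : Simulation (σ.comp τ) (σ'.comp τ') where
  -- Simulations fix the borders, so the map on the shared border is the identity.
  hom := pushout.map _ _ _ _ f.hom g.hom (𝟙 _) (by rw [f.target_hom, Category.id_comp])
    (by rw [g.source_hom, Category.id_comp])
  source_hom := by simp [reassoc_of% f.source_hom]
  target_hom := by simp [reassoc_of% g.target_hom]
  hom_label := by
    apply pushout.hom_ext <;> simp [reassoc_of% f.hom_label, reassoc_of% g.hom_label]

/-- Relabeling is functorial in simulations. -/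
def push {f : J → J'} {X : Opcategory S J} {Y : Opcategory S J'} (F : InternalFunctor f X Y)
    {i j : J} {A : Game X i} {B : Game X j} {σ τ : Cobordism A B} (h : Simulation σ τ) :
    Simulation (σ.push F) (τ.push F) where
  hom := h.hom
  source_hom := h.source_hom
  target_hom := h.target_hom
  hom_label := by rw [reassoc_of% h.hom_label]

/-- Relabeling commutes with sequential composition. -/
noncomputable def compPush {f : J → J'} {X : Opcategory S J} {Y : Opcategory S J'}
    (F : InternalFunctor f X Y) {i j k : J} {A : Game X i} {B : Game X j} {C : Game X k}
    (σ : Cobordism A B) (τ : Cobordism B C) :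
    Simulation ((σ.push F).comp (τ.push F)) ((σ.comp τ).push F) where
  -- Relabeling leaves supports untouched, so both sides are the same pushout; only the labels
  -- differ, and `F.mu_map` identifies them.
  hom := 𝟙 _
  source_hom := Category.comp_id _
  target_hom := Category.comp_id _
  hom_label := by
    apply pushout.hom_ext <;> simp [F.mu_map]

/-- The lax compatibility of pulling with sequential composition. -/
noncomputable def compPull [HasPullbacks S] {X Y : Opcategory S J} (F : PlainFunctor X Y)
    {i j k : J} {A : Game Y i} {B : Game Y j} {C : Game Y k} (σ : Cobordism A B)
    (τ : Cobordism B C) :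
    Simulation ((σ.pull F).comp (τ.pull F)) ((σ.comp τ).pull F) where
  -- On each piece, the second component is pushed into `X.obj1 i k` by the multiplication of `X`.
  -- It lies over the label of `σ.comp τ` because `F` commutes with the multiplications.
  hom := pushout.desc
    (pullback.lift (pullback.fst _ _ ≫ pushout.inl _ _)
      (pullback.snd _ _ ≫ pushout.inl _ _ ≫ X.mu i j k)
      (by simp [F.mu_map, pullback.condition_assoc]))
    (pullback.lift (pullback.fst _ _ ≫ pushout.inr _ _)
      (pullback.snd _ _ ≫ pushout.inr _ _ ≫ X.mu i j k)
      (by simp [F.mu_map, pullback.condition_assoc]))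
    -- Agreement on the shared border: in the first component it is the gluing of `σ` and `τ`, in
    -- the second the gluing of the cospans of `X` that is the domain of `X.mu`.
    (by
      apply pullback.hom_ext
      · simp [pushout.condition]
      · simp [pushout.condition_assoc])
  source_hom := by
    apply pullback.hom_ext <;> simp [X.inp_mu]
  target_hom := by
    apply pullback.hom_ext <;> simp [X.out_mu]
  hom_label := by
    apply pushout.hom_ext <;> simp

/-- Pulling is functorial in simulations. -/
noncomputable def pull [HasPullbacks S] {X Y : Opcategory S J} (F : PlainFunctor X Y) {i j : J}
    {A : Game Y i} {B : Game Y j} {σ τ : Cobordism A B} (h : Simulation σ τ) :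
    Simulation (σ.pull F) (τ.pull F) where
  hom := pullback.map _ _ _ _ h.hom (𝟙 _) (𝟙 _) (by rw [h.hom_label, Category.comp_id])
    (by rw [Category.id_comp, Category.comp_id])
  source_hom := by
    apply pullback.hom_ext <;> simp [h.source_hom]
  target_hom := by
    apply pullback.hom_ext <;> simp [h.target_hom]
  hom_label := by simp

/-- The pointwise product is functorial in simulations. -/
noncomputable def prod [HasBinaryProducts S] {X : Opcategory S J} {Y : Opcategory S J'}
    {i j : J} {i' j' : J'} {A : Game X i} {B : Game X j} {A' : Game Y i'} {B' : Game Y j'}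
    {σ τ : Cobordism A B} {σ' τ' : Cobordism A' B'} (f : Simulation σ τ)
    (g : Simulation σ' τ') : Simulation (σ.prod σ') (τ.prod τ') where
  hom := Limits.prod.map f.hom g.hom
  source_hom := by rw [prod.map_map, f.source_hom, g.source_hom]
  target_hom := by rw [prod.map_map, f.target_hom, g.target_hom]
  hom_label := by rw [prod.map_map, f.hom_label, g.hom_label]

/-- The lax compatibility of pointwise products with sequential composition. -/
noncomputable def compProd [HasBinaryProducts S] {X : Opcategory S J} {Y : Opcategory S J'}
    {i j k : J} {i' j' k' : J'} {A : Game X i} {B : Game X j} {C : Game X k} {A' : Game Y i'}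
    {B' : Game Y j'} {C' : Game Y k'} (σ : Cobordism A B) (τ : Cobordism B C)
    (σ' : Cobordism A' B') (τ' : Cobordism B' C') :
    Simulation ((σ.prod σ').comp (τ.prod τ')) ((σ.comp τ).prod (σ'.comp τ')) where
  -- The image uses only pairs of pieces on the same side of the cut. A product of pushouts may also
  -- contain mixed pairs, which is why the comparison goes in this direction.
  hom := pushout.desc (Limits.prod.map (pushout.inl _ _) (pushout.inl _ _))
    (Limits.prod.map (pushout.inr _ _) (pushout.inr _ _))
    (by rw [prod.map_map, prod.map_map, pushout.condition, pushout.condition])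
  source_hom := by simp
  target_hom := by simp
  hom_label := by
    apply pushout.hom_ext <;> simp

/-! ### Lax interchange and the Hoare inequality -/

section Parallel

variable [HasPullbacks S] [HasBinaryProducts S] {X : Opcategory S J}
  (P : AcuteSpan (X.prod X) X)

/-- The parallel product is functorial in simulations. -/
noncomputable def par {i i' j j' : J} {A : Game X i} {B : Game X j} {A' : Game X i'}
    {B' : Game X j'} {σ τ : Cobordism A B} {σ' τ' : Cobordism A' B'} (f : Simulation σ τ)
    (g : Simulation σ' τ') : Simulation (σ.par P σ') (τ.par P τ') :=
  ((f.prod g).pull P.left).push P.right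

/-- The lax interchange of sequential and parallel composition. -/
noncomputable def compPar {i j k i' j' k' : J} {A : Game X i} {B : Game X j} {C : Game X k}
    {A' : Game X i'} {B' : Game X j'} {C' : Game X k'} (σ : Cobordism A B) (τ : Cobordism B C)
    (σ' : Cobordism A' B') (τ' : Cobordism B' C') :
    Simulation ((σ.par P σ').comp (τ.par P τ')) ((σ.comp τ).par P (σ'.comp τ')) :=
  -- The layers of the parallel product are crossed from the outside in: first the relabeling by
  -- `pince`, then the pullback along `pick`, then the product.
  (compPush P.right _ _).trans
    (((compPull P.left _ _).trans ((compProd σ τ σ' τ').pull P.left)).push P.right)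

/-- The Hoare inequality: a map from the filling between parallel products to the parallel product
of the fillings induces one between the filled composites. -/
noncomputable def seqPar (F : FillingSystem X) {i j j' k l m m' n : J} {A : Game X i}
    {B : Game X j} {B' : Game X j'} {C : Game X k} {D : Game X l} {E : Game X m}
    {E' : Game X m'} {G : Game X n} (C₁ : Cobordism A B) (C₂ : Cobordism B' C)
    (D₁ : Cobordism D E) (D₂ : Cobordism E' G)
    (h : Simulation (F.fill (B.par P E) (B'.par P E')) ((F.fill B B').par P (F.fill E E'))) :
    Simulation (F.seq (C₁.par P D₁) (C₂.par P D₂)) ((F.seq C₁ C₂).par P (F.seq D₁ D₂)) :=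
  -- `h` acts on the middle factor, the first interchange merges it with the left factors, and the
  -- second interchange absorbs the right factors.
  ((((refl _).comp h).trans (compPar P _ _ _ _)).comp (refl _)).trans (compPar P _ _ _ _)

end Parallel

end Simulation

/-! ### Canonical fillings and parallel products -/

/-- The canonical fillings map to parallel products as soon as any two maps to the borders of the
apex that `pince` identifies in `X.obj1` are already identified in the apex. -/
theorem FillingSystem.canonical_mapsToParallel [HasPullbacks S] [HasBinaryProducts S]
    {X : Opcategory S J} (P : AcuteSpan (X.prod X) X)
    (hP : ∀ {i j : J × J} {W : S} (x : W ⟶ P.apex.obj0 i) (y : W ⟶ P.apex.obj0 j),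
      x ≫ P.right.map0 i ≫ X.inp (P.color i) (P.color j) =
          y ≫ P.right.map0 j ≫ X.out (P.color i) (P.color j) →
        x ≫ P.apex.inp i j = y ≫ P.apex.out i j) :
    (FillingSystem.canonical X).MapsToParallel P := by
  intro i i' j j' A A' B B'
  let τ := ((FillingSystem.canonical X).fill A B).par P ((FillingSystem.canonical X).fill A' B')
  let p := pullback.fst ((A.par P A').label ≫ X.inp (P.color (i, i')) (P.color (j, j')))
    ((B.par P B').label ≫ X.out (P.color (i, i')) (P.color (j, j')))
  let q := pullback.snd ((A.par P A').label ≫ X.inp (P.color (i, i')) (P.color (j, j')))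
    ((B.par P B').label ≫ X.out (P.color (i, i')) (P.color (j, j')))
  -- The defining pullback gives this equation only after `pince`; the hypothesis `hP` lifts it to
  -- the apex.
  have h : p ≫ pullback.snd (Limits.prod.map A.label A'.label) _ ≫ P.apex.inp (i, i') (j, j') =
      q ≫ pullback.snd (Limits.prod.map B.label B'.label) _ ≫ P.apex.out (i, i') (j, j') := by
    rw [← Category.assoc, ← Category.assoc]
    exact hP _ _ (by
      simpa [p, q] using pullback.condition
        (f := (A.par P A').label ≫ X.inp (P.color (i, i')) (P.color (j, j')))
        (g := (B.par P B').label ≫ X.out (P.color (i, i')) (P.color (j, j'))))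
  have h' : p ≫ pullback.fst _ _ ≫ Limits.prod.map (A.label ≫ X.inp i j) (A'.label ≫ X.inp i' j') =
      q ≫ pullback.fst _ _ ≫ Limits.prod.map (B.label ≫ X.out i j) (B'.label ≫ X.out i' j') := by
    -- Applying `pick` to the equation in the apex, and trading the apex labels for the product
    -- labels, recovers the agreement of the labels seen by each of the two codes.
    have h₁ := h =≫ P.left.map1 (i, i') (j, j')
    simp only [Category.assoc, P.left.inp_map, P.left.out_map] at h₁
    rw [← pullback.condition_assoc, ← pullback.condition_assoc] at h₁
    simpa [prod.map_map] using h₁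
  have key : p ≫ τ.source = q ≫ τ.target := by
    -- A pair of maps that agree over `Y` factors through the pullback, and the pushout over that
    -- pullback identifies them.
    have glue {Y : S} {Z Z' : S} {f : Z ⟶ Y} {g : Z' ⟶ Y} {W : S} (x : W ⟶ Z) (y : W ⟶ Z')
        (e : x ≫ f = y ≫ g) :
        x ≫ pushout.inl (pullback.fst f g) (pullback.snd f g) = y ≫ pushout.inr _ _ := by
      have := pullback.lift x y e ≫= pushout.condition (f := pullback.fst f g)
        (g := pullback.snd f g)
      simpa using this
    -- The support of `τ` is a pullback of a product, so there are three components: `glue` settles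
    -- the two fillings by means of `h'`, and `h` settles the apex label.
    apply pullback.hom_ext
    · apply Limits.prod.hom_ext
      · simpa [τ] using glue (p ≫ pullback.fst _ _ ≫ Limits.prod.fst)
          (q ≫ pullback.fst _ _ ≫ Limits.prod.fst) (by simpa using h' =≫ Limits.prod.fst)
      · simpa [τ] using glue (p ≫ pullback.fst _ _ ≫ Limits.prod.snd)
          (q ≫ pullback.fst _ _ ≫ Limits.prod.snd) (by simpa using h' =≫ Limits.prod.snd)
    · simpa [τ] using h
  -- The legs of `τ` determine the map on the two glued pieces, so its compatibility with labels
  -- reduces to the border laws of `τ`.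
  exact ⟨{
    hom := pushout.desc τ.source τ.target key
    source_hom := pushout.inl_desc _ _ _
    target_hom := pushout.inr_desc _ _ _
    hom_label := by
      apply pushout.hom_ext
      · rw [pushout.inl_desc_assoc, pushout.inl_desc]
        exact τ.source_label
      · rw [pushout.inr_desc_assoc, pushout.inr_desc]
        exact τ.target_label }⟩

end Simulations

/-! ### Templates of machine models -/

namespace AGraph

/-- The first projection retracts `M.frame`, so two maps into `M` that agree after `frame` are
equal, and in particular agree after `frame₃`. Tiles play no role. -/
theorem template_mapsToParallel (M : AGraph.{t}) :
    (FillingSystem.canonical M.template).MapsToParallel M.parallel := by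
  refine FillingSystem.canonical_mapsToParallel _ fun x y h => ?_
  have h' : x ≫ M.frame = y ≫ M.frame := by simpa using h
  have hxy := h' =≫ Limits.prod.fst
  rw [Category.assoc, Category.assoc, frame, prod.lift_fst, Category.comp_id,
    Category.comp_id] at hxy
  rw [hxy]

end AGraph

end Cobord

theorem mainTheorem6 :
    (∀ {S : Type u} [Category.{v} S] [HasPushouts S] [HasPullbacks S] [HasBinaryProducts S]
        {J : Type w} {X : Opcategory S J} (P : AcuteSpan (X.prod X) X) (F : FillingSystem X)
        {i j j' k : J} {A : Game X i} {B : Game X j} {B' : Game X j'} {C : Game X k}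
        {l m m' n : J} {D : Game X l} {E : Game X m} {E' : Game X m'} {G : Game X n}
        (C₁ : Cobordism A B) (C₂ : Cobordism B' C) (D₁ : Cobordism D E) (D₂ : Cobordism E' G),
        Nonempty (Simulation (F.fill (B.par P E) (B'.par P E'))
          ((F.fill B B').par P (F.fill E E'))) →
        Nonempty (Simulation (F.seq (C₁.par P D₁) (C₂.par P D₂))
          ((F.seq C₁ C₂).par P (F.seq D₁ D₂)))) ∧
    (∀ M : AGraph.{t}, (FillingSystem.canonical M.template).MapsToParallel M.parallel) ∧
    (∀ Γ : Signature.{t}, (FillingSystem.canonical (statefulModel Γ).template).MapsToParallel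
      (statefulModel Γ).parallel) ∧
    (∀ Γ : Signature.{t}, (FillingSystem.canonical (statelessModel Γ).template).MapsToParallel
      (statelessModel Γ).parallel) := by
  -- The stateful and stateless models are instances of the statement for all `M`; their transitions
  -- and independence relations do not enter.
  refine ⟨?_, AGraph.template_mapsToParallel, fun _ => AGraph.template_mapsToParallel _,
    fun _ => AGraph.template_mapsToParallel _⟩
  intro S _ _ _ _ J X P F i j j' k A B B' C l m m' n D E E' G C₁ C₂ D₁ D₂ ⟨h⟩
  exact ⟨Simulation.seqPar P F C₁ C₂ D₁ D₂ h⟩
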